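/- All graphs are finite and simple. A graph is $k$-degenerate if each nonempty subgraph has a vertex of degree at most $k$ (in that subgraph), and the square $G^2$ is formed from $G$ by adding an edge between each pair of vertices at distance $2$ in $G$. Let $k$ and $D$ be integers with $D\ge k\ge 2$, and let $S$ be a set whose size $|S|$ is a multiple of $kD$ with $|S|\ge 2kD^2$ (for instance $|S|=2kD^2$). Then there are $D$ partitions of $S$ such that each of the first $k$ has all its parts of size $D$, each of the other $D-k$ has all its parts of size $k$, and each pair of distinct elements of $S$ lies in a common part in at most one of the $D$ partitions, and such that the following holds. Let $H_{D,k}$ be the graph with vertex set $S$ together with one new vertex $w_A$ for each part $A$ of each of the $D$ partitions, where $w_A$ is adjacent to precisely the elements of $A$ and there are no other edges. Then $H_{D,k}$ is $k$-degenerate and has maximum degree $D$; its square $H_{D,k}^2$ is not $((2k-1)D-k^2-1)$-degenerate; and the subgraph $H_{D,k}^2[S]$ of the square induced by $S$ has minimum degree exactly $k(D-1)+(D-k)(k-1)$. -/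

import Mathlib

namespace SquareDegeneracy

/-- `G` is `k`-degenerate: each (nonempty) subgraph of `G` has a vertex of degree at most `k`
in that subgraph. -/
def IsDegenerate {V : Type*} (k : ℕ) (G : SimpleGraph V) : Prop :=
  ∀ H : G.Subgraph, H.verts.Nonempty → ∃ v ∈ H.verts, (H.neighborSet v).encard ≤ k

/-- The square `G²`, formed from `G` by adding an edge between each pair of vertices at
distance 2 in `G`. -/
def square {V : Type*} (G : SimpleGraph V) : SimpleGraph V where
  Adj u v := G.Adj u v ∨ G.dist u v = 2
  symm := ⟨fun u v h => by rwa [G.adj_comm, G.dist_comm]⟩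
  loopless := ⟨fun u h => by simp at h⟩

/-- A family of `D` partitions of `S`: the first `k` of them have all parts of size `D`, the
other `D - k` have all parts of size `k`, and no two distinct elements of `S` lie in a common
part for two different partitions of the family. -/
structure IsPartitionSystem {S : Type*} [Fintype S] [DecidableEq S] (k D : ℕ)
    (P : Fin D → Finpartition (Finset.univ : Finset S)) : Prop where
  card_first : ∀ i : Fin D, (i : ℕ) < k → ∀ A ∈ (P i).parts, A.card = D
  card_second : ∀ i : Fin D, k ≤ (i : ℕ) → ∀ A ∈ (P i).parts, A.card = k
  at_most_once : ∀ i j : Fin D, ∀ A ∈ (P i).parts, ∀ B ∈ (P j).parts, ∀ u v : S,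
    u ≠ v → u ∈ A → v ∈ A → u ∈ B → v ∈ B → i = j

/-- The vertices of the constructed graph: the elements of `S` (`Sum.inl`), and one further
vertex for each part of each partition of the family (`Sum.inr`). -/
abbrev Vertex {S ι : Type*} [Fintype S] [DecidableEq S]
    (P : ι → Finpartition (Finset.univ : Finset S)) : Type _ :=
  S ⊕ (Σ i : ι, {A : Finset S // A ∈ (P i).parts})

/-- The constructed graph: the vertex of a part `A` is adjacent to precisely the elements
of `A`, and there are no other edges. -/
def partGraph {S ι : Type*} [Fintype S] [DecidableEq S]
    (P : ι → Finpartition (Finset.univ : Finset S)) : SimpleGraph (Vertex P) where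
  Adj x y := match x, y with
    | Sum.inl v, Sum.inr w => v ∈ w.2.1
    | Sum.inr w, Sum.inl v => v ∈ w.2.1
    | _, _ => False
  symm := ⟨fun x y h => by cases x <;> cases y <;> exact h⟩
  loopless := ⟨fun x h => by cases x <;> exact h⟩

end SquareDegeneracy

open scoped Classical

/-! The partitions are chosen greedily. Join two elements of `S` when they already share a part; the
next partition is an equitable colouring of this conflict graph, so it repeats no pair. The size of
`S` makes the number of colours at least twice the conflict degree, and then a swap argument
replaces Hajnal–Szemerédi (`exists_bounded_coloring_insert`, `exists_linear_partitions`). In the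
square, two elements of `S` are adjacent iff they share a part. As no pair repeats, every element
has exactly `k(D-1) + (D-k)(k-1) = (2k-1)D - k²` neighbours in `S`, so the subgraph induced by `S`
refutes the degeneracy bound. -/

namespace SquareDegeneracy

open Finset

/-! ### Equitable colouring -/

/-- Vertices can be added one at a time to a proper partial colouring with bounded class sizes, as
long as the number of colours is at least twice the maximum degree. -/
theorem exists_bounded_coloring_insert {V : Type*} [Fintype V] [DecidableEq V] (G : SimpleGraph V)
    [DecidableRel G.Adj] {r s d : ℕ} (hd : ∀ v, G.degree v ≤ d) (hr : 2 * d ≤ r)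
    {T : Finset V} {v : V} (hv : v ∉ T) (hT : #T < r * s) {c : V → Fin r}
    (hc : ∀ x ∈ T, ∀ y ∈ T, G.Adj x y → c x ≠ c y)
    (hs : ∀ j, #{x ∈ T | c x = j} ≤ s) :
    ∃ c' : V → Fin r, (∀ x ∈ insert v T, ∀ y ∈ insert v T, G.Adj x y → c' x ≠ c' y) ∧
      ∀ j, #{x ∈ insert v T | c' x = j} ≤ s := by
  by_cases hfree : ∃ j, #{x ∈ T | c x = j} < s ∧ ∀ x ∈ T, G.Adj v x → c x ≠ j
  · obtain ⟨j, hj, hvj⟩ := hfree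
    refine ⟨Function.update c v j, ?_, ?_⟩
    · intro x hx y hy hxy
      have := G.ne_of_adj hxy
      have := hxy.symm
      simp only [mem_insert] at hx hy
      grind [Function.update_apply]
    · intro i
      by_cases hi : i = j
      · subst hi
        calc #{x ∈ insert v T | Function.update c v i x = i}
            ≤ #(insert v {x ∈ T | c x = i}) := by
              apply card_le_card
              intro x
              simp only [mem_filter, mem_insert, Function.update_apply]
              grind
          _ ≤ s := (card_insert_le _ _).trans hj
      · refine le_trans (card_le_card ?_) (hs i)
        intro x
        simp only [mem_filter, mem_insert, Function.update_apply]
        grind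
  · push Not at hfree
    obtain ⟨w, hw⟩ : ∃ w, #{x ∈ T | c x = w} < s := by
      by_contra! h
      have : ∑ j : Fin r, #{x ∈ T | c x = j} = #T :=
        (card_eq_sum_card_fiberwise (fun x _ => mem_univ (c x))).symm
      have h2 : ∑ _j : Fin r, s ≤ ∑ j : Fin r, #{x ∈ T | c x = j} :=
        sum_le_sum fun j _ => h j
      simp at h2
      omega
    -- The colours unused around `v`: at least `r - d ≥ d` of them, and all their classes are full.
    set F : Finset (Fin r) := univ \ ((G.neighborFinset v).image c) with hF
    have hFcard : r ≤ #F + d := by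
      have h1 : #((G.neighborFinset v).image c) ≤ d := card_image_le.trans (hd v)
      have h2 := le_card_sdiff ((G.neighborFinset v).image c) (univ : Finset (Fin r))
      rw [← hF] at h2
      simp at h2
      omega
    have hFree : ∀ j ∈ F, ∀ x, G.Adj v x → c x ≠ j := by
      intro j hj x hx hxj
      simp only [hF, mem_sdiff, mem_univ, true_and, mem_image, SimpleGraph.mem_neighborFinset,
        not_exists, not_and] at hj
      exact hj x hx hxj
    have hFull : ∀ j ∈ F, #{x ∈ T | c x = j} = s := by
      intro j hj
      refine (hs j).antisymm ?_
      by_contra! h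
      obtain ⟨x, -, hx, hxj⟩ := hfree j h
      exact hFree j hj x hx hxj
    have hwF : w ∉ F := fun h => hw.ne (hFull w h)
    -- Class `w` has fewer than `s` vertices, hence fewer than `d * s` neighbours when `d > 0`,
    -- while the classes in `F` hold at least `d * s` vertices. Some `u` among these can move to
    -- `w`, and `v` takes its place.
    obtain ⟨u, huT, huF, huw⟩ :
        ∃ u ∈ T, c u ∈ F ∧ ∀ x ∈ T, c x = w → ¬ G.Adj u x := by
      by_contra! h
      have h1 : #{x ∈ T | c x ∈ F} = #F * s := by
        have hmap : Set.MapsTo c ({x ∈ T | c x ∈ F} : Finset V) F :=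
          fun x hx => (mem_filter.1 hx).2
        rw [card_eq_sum_card_fiberwise hmap, sum_congr rfl (g := fun _ => s)]
        · simp
        · intro j hj
          rw [← hFull j hj]
          congr 1
          ext x
          simp only [mem_filter]
          grind
      have h2 : {x ∈ T | c x ∈ F} ⊆ {x ∈ T | c x = w}.biUnion fun y => G.neighborFinset y := by
        intro x hx
        obtain ⟨y, hy, hyw, hxy⟩ := h x (mem_filter.1 hx).1 (mem_filter.1 hx).2
        exact mem_biUnion.2 ⟨y, mem_filter.2 ⟨hy, hyw⟩, by simpa using hxy.symm⟩
      have h3 : #({x ∈ T | c x = w}.biUnion fun y => G.neighborFinset y) ≤ #{x ∈ T | c x = w} * d :=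
        card_biUnion_le_card_mul _ _ _ fun x _ => hd x
      have h4 := card_le_card h2
      have h5 : 0 < r := w.pos
      obtain rfl | hd0 := Nat.eq_zero_or_pos d
      · nlinarith
      · nlinarith [Nat.mul_lt_mul_of_pos_right hw hd0]
    have huv : u ≠ v := fun h => hv (h ▸ huT)
    have hcuw : c u ≠ w := fun h => hwF (h ▸ huF)
    have hvu := hFree _ huF
    refine ⟨Function.update (Function.update c u w) v (c u), ?_, ?_⟩
    · intro x hx y hy hxy
      have := G.ne_of_adj hxy
      have := hxy.symm
      simp only [mem_insert] at hx hy
      simp only [Function.update_apply]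
      clear hF hFcard hFree hFull hwF huF hfree hs hw hT hd
      grind
    · intro i
      by_cases hiw : i = w
      · subst hiw
        calc _ ≤ #(insert u {x ∈ T | c x = i}) := by
              apply card_le_card
              intro x
              simp only [mem_filter, mem_insert, Function.update_apply]
              grind
          _ ≤ s := (card_insert_le _ _).trans hw
      by_cases hiu : i = c u
      · calc _ ≤ #(insert v ({x ∈ T | c x = i}.erase u)) := by
              apply card_le_card
              intro x
              simp only [mem_filter, mem_insert, mem_erase, Function.update_apply]
              grind
          _ ≤ #({x ∈ T | c x = i}.erase u) + 1 := card_insert_le _ _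
          _ = #{x ∈ T | c x = i} := card_erase_add_one (by simp [huT, hiu])
          _ ≤ s := hs i
      · refine le_trans (card_le_card ?_) (hs i)
        intro x
        simp only [mem_filter, mem_insert, Function.update_apply]
        grind

/-- A weak form of the Hajnal–Szemerédi theorem: a graph whose maximum degree is at most half the
number `r` of colours has an equitable colouring. -/
theorem exists_equitable_coloring {V : Type*} [Fintype V] [DecidableEq V] (G : SimpleGraph V)
    [DecidableRel G.Adj] {r s d : ℕ} (hd : ∀ v, G.degree v ≤ d) (hr : 2 * d ≤ r) (hr0 : 0 < r)
    (hV : r * s = Fintype.card V) :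
    ∃ c : V → Fin r, (∀ x y, G.Adj x y → c x ≠ c y) ∧ ∀ j, #{x | c x = j} = s := by
  have key : ∀ T : Finset V, ∃ c : V → Fin r,
      (∀ x ∈ T, ∀ y ∈ T, G.Adj x y → c x ≠ c y) ∧ ∀ j, #{x ∈ T | c x = j} ≤ s := by
    intro T
    induction T using Finset.induction_on with
    | empty => exact ⟨fun _ => ⟨0, hr0⟩, by simp, by simp⟩
    | insert v T hv ih =>
      obtain ⟨c, hc, hs⟩ := ih
      refine exists_bounded_coloring_insert G hd hr hv ?_ hc hs
      rw [hV]
      exact card_lt_univ_of_notMem hv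
  obtain ⟨c, hc, hs⟩ := key univ
  refine ⟨c, fun x y => hc x (mem_univ x) y (mem_univ y), ?_⟩
  -- The `r` classes of size at most `s` cover `r * s` vertices, so all are full.
  have h1 : ∑ j : Fin r, #{x | c x = j} = ∑ _j : Fin r, s := by
    rw [← card_eq_sum_card_fiberwise (fun x _ => mem_univ (c x))]
    simp [hV]
  have h2 := (sum_eq_sum_iff_of_le fun j _ => hs j).1 h1
  exact fun j => h2 j (mem_univ j)

theorem exists_equitable_finpartition {V : Type*} [Fintype V] [DecidableEq V] (G : SimpleGraph V)
    [DecidableRel G.Adj] {r s d : ℕ} (hd : ∀ v, G.degree v ≤ d) (hr : 2 * d ≤ r) (hr0 : 0 < r)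
    (hV : r * s = Fintype.card V) :
    ∃ P : Finpartition (univ : Finset V), (∀ A ∈ P.parts, #A = s) ∧
      ∀ u v, v ∈ P.part u → ¬ G.Adj u v := by
  obtain ⟨c, hc, hs⟩ := exists_equitable_coloring G hd hr hr0 hV
  refine ⟨Finpartition.ofSetoid (Setoid.ker c), ?_, ?_⟩
  · intro A hA
    simp only [Finpartition.ofSetoid, Finpartition.ofSetSetoid, mem_image, mem_univ,
      true_and] at hA
    obtain ⟨a, rfl⟩ := hA
    rw [← hs (c a)]
    congr 1
    ext b
    simp [Setoid.ker_def, eq_comm]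
  · intro u v h huv
    rw [Finpartition.mem_part_ofSetoid_iff_rel] at h
    exact hc u v huv h

/-! ### Greedy choice of the partitions -/

theorem card_biUnion_part_erase_le {S ι : Type*} [Fintype S] [DecidableEq S]
    {P : ι → Finpartition (univ : Finset S)} {sz : ι → ℕ} {I : Finset ι}
    (hP : ∀ i ∈ I, ∀ A ∈ (P i).parts, #A = sz i) (v : S) :
    #(I.biUnion fun i => ((P i).part v).erase v) ≤ ∑ i ∈ I, (sz i - 1) := by
  refine card_biUnion_le.trans (sum_le_sum fun i hi => ?_)
  rw [card_erase_of_mem ((P i).mem_part (mem_univ v)),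
    hP i hi _ ((P i).part_mem.2 (mem_univ v))]

theorem card_biUnion_part_erase {S ι : Type*} [Fintype S] [DecidableEq S]
    {P : ι → Finpartition (univ : Finset S)} {sz : ι → ℕ} {I : Finset ι}
    (hP : ∀ i ∈ I, ∀ A ∈ (P i).parts, #A = sz i)
    (hlin : ∀ i ∈ I, ∀ j ∈ I, ∀ u v, u ≠ v → v ∈ (P i).part u → v ∈ (P j).part u → i = j)
    (v : S) :
    #(I.biUnion fun i => ((P i).part v).erase v) = ∑ i ∈ I, (sz i - 1) := by
  rw [card_biUnion]
  · refine sum_congr rfl fun i hi => ?_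
    rw [card_erase_of_mem ((P i).mem_part (mem_univ v)),
      hP i hi _ ((P i).part_mem.2 (mem_univ v))]
  · intro i hi j hj hij
    rw [Function.onFun, disjoint_left]
    intro u hu hu'
    rw [mem_erase] at hu hu'
    exact hij (hlin i hi j hj v u hu.1.symm hu.2 hu'.2)

/-- Equitable partitions with prescribed part sizes in which no pair is covered twice can be
chosen greedily. -/
theorem exists_linear_partitions {S : Type*} [Fintype S] [DecidableEq S] (sz r : ℕ → ℕ) (n : ℕ)
    (hS : ∀ i < n, r i * sz i = Fintype.card S) (hr0 : ∀ i < n, 0 < r i)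
    (hr : ∀ i < n, 2 * ∑ j ∈ range i, (sz j - 1) ≤ r i) :
    ∃ P : ℕ → Finpartition (univ : Finset S),
      (∀ i < n, ∀ A ∈ (P i).parts, #A = sz i) ∧
      ∀ i < n, ∀ j < n, ∀ u v, u ≠ v → v ∈ (P i).part u → v ∈ (P j).part u → i = j := by
  classical
  induction n with
  | zero => exact ⟨fun _ => ⊥, by simp, by simp⟩
  | succ n ih =>
    obtain ⟨P, hP, hlin⟩ := ih (fun i hi => hS i (by omega)) (fun i hi => hr0 i (by omega))
      (fun i hi => hr i (by omega))
    -- The conflict graph: pairs covered by one of the first `n` partitions.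
    let G : SimpleGraph S :=
      { Adj := fun u v => u ≠ v ∧ ∃ i < n, v ∈ (P i).part u
        symm := ⟨fun u v ⟨h, i, hi, hv⟩ => ⟨h.symm, i, hi, by
          rw [(P i).mem_part_iff_part_eq_part (mem_univ _) (mem_univ _)] at hv ⊢
          exact hv.symm⟩⟩
        loopless := ⟨fun u h => h.1 rfl⟩ }
    have hdeg : ∀ v, G.degree v ≤ ∑ j ∈ range n, (sz j - 1) := by
      intro v
      refine le_trans (card_le_card ?_) (card_biUnion_part_erase_le (P := P) (I := range n)
        (fun i hi => hP i (mem_range.1 hi)) v)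
      intro u hu
      rw [SimpleGraph.mem_neighborFinset] at hu
      obtain ⟨h, i, hi, hv⟩ := hu
      exact mem_biUnion.2 ⟨i, mem_range.2 hi, mem_erase.2 ⟨h.symm, hv⟩⟩
    obtain ⟨Q, hQ, hQG⟩ := exists_equitable_finpartition G hdeg (hr n (by omega))
      (hr0 n (by omega)) (hS n (by omega))
    refine ⟨Function.update P n Q, ?_, ?_⟩
    · intro i hi
      obtain rfl | hin := eq_or_ne i n
      · simpa using hQ
      · rw [Function.update_of_ne hin]
        exact hP i (by omega)
    · intro i hi j hj u v huv hvi hvj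
      obtain rfl | hin := eq_or_ne i n <;> obtain rfl | hjn := eq_or_ne j i
      · rfl
      · rw [Function.update_self] at hvi
        rw [Function.update_of_ne hjn] at hvj
        exact absurd ⟨huv, j, by omega, hvj⟩ (hQG u v hvi)
      · rfl
      · rw [Function.update_of_ne hin] at hvi
        obtain rfl | hjn' := eq_or_ne j n
        · rw [Function.update_self] at hvj
          exact absurd ⟨huv, i, by omega, hvi⟩ (hQG u v hvj)
        · rw [Function.update_of_ne hjn'] at hvj
          exact hlin i (by omega) j (by omega) u v huv hvi hvj

/-- The sizes of the parts of the partitions in a partition system. -/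
def partSize (k D i : ℕ) : ℕ := if i < k then D else k

theorem sum_range_partSize {k D n : ℕ} (hn : k ≤ n) :
    ∑ i ∈ range n, (partSize k D i - 1) = k * (D - 1) + (n - k) * (k - 1) := by
  obtain ⟨m, rfl⟩ := Nat.exists_eq_add_of_le hn
  rw [sum_range_add]
  congr 1
  · rw [sum_congr rfl (g := fun _ => D - 1)]
    · simp
    · intro i hi
      simp [partSize, mem_range.1 hi]
  · simp [partSize]

theorem sum_range_partSize_le {k D n : ℕ} (hn : n ≤ k) :
    ∑ i ∈ range n, (partSize k D i - 1) = n * (D - 1) := by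
  rw [sum_congr rfl (g := fun _ => D - 1)]
  · simp
  · intro i hi
    simp [partSize, (mem_range.1 hi).trans_le hn]

theorem exists_isPartitionSystem {k D N : ℕ} (hk : 2 ≤ k) (hkD : k ≤ D)
    (hN : 2 * k * D ^ 2 ≤ N) (hdvd : k * D ∣ N) :
    ∃ P : Fin D → Finpartition (univ : Finset (Fin N)), IsPartitionSystem k D P := by
  obtain ⟨m, rfl⟩ := hdvd
  have hm : 2 * D ≤ m := by
    have : 0 < k * D := Nat.mul_pos (by omega) (by omega)
    refine Nat.le_of_mul_le_mul_left ?_ this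
    calc k * D * (2 * D) = 2 * k * D ^ 2 := by ring
      _ ≤ _ := hN
  obtain ⟨P, hP, hlin⟩ := exists_linear_partitions (S := Fin (k * D * m)) (partSize k D)
    (fun i => if i < k then k * m else D * m) D
    (by
      intro i _
      simp only [partSize, Fintype.card_fin]
      split_ifs <;> ring)
    (by
      intro i _
      have : 0 < m := by omega
      split_ifs
      · positivity
      · have : 0 < D := by omega
        positivity)
    (by
      intro i hi
      split_ifs with h
      · rw [sum_range_partSize_le h.le]
        have h1 : i * (D - 1) ≤ k * D := Nat.mul_le_mul h.le (by omega)
        nlinarith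
      -- Here `k(D-1) + (D-k)(k-1) ≤ D² - D` because `(D-k)² ≥ 0`, while there are `D * m ≥ 2D²`
      -- colours.
      · rw [sum_range_partSize (not_lt.1 h)]
        obtain ⟨d, rfl⟩ := Nat.exists_eq_add_of_le hkD
        obtain ⟨l, rfl⟩ := Nat.exists_eq_add_of_le hk
        have h1 : i - (2 + l) ≤ d := by omega
        have h2 : (i - (2 + l)) * (2 + l - 1) ≤ d * (1 + l) := Nat.mul_le_mul h1 (by omega)
        have h3 : 2 + l + d - 1 = 1 + l + d := by omega
        rw [h3]
        nlinarith [Nat.mul_le_mul_left (2 + l + d) hm])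
  refine ⟨fun i => P i, ?_, ?_, ?_⟩
  · intro i hi A hA
    rw [hP i i.2 A hA, partSize, if_pos hi]
  · intro i hi A hA
    rw [hP i i.2 A hA, partSize, if_neg (by omega)]
  · intro i j A hA B hB u v huv huA hvA huB hvB
    refine Fin.ext (hlin i i.2 j j.2 u v huv ?_ ?_)
    · rwa [(P i).part_eq_of_mem hA huA]
    · rwa [(P j).part_eq_of_mem hB huB]

/-! ### Adjacency in the graph and its square -/

section PartGraph

variable {S ι : Type*} [Fintype S] [DecidableEq S] (P : ι → Finpartition (univ : Finset S))

/-- The vertex for the part of `v` in the `i`-th partition. -/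
def partVertex (v : S) (i : ι) : Σ i : ι, {A : Finset S // A ∈ (P i).parts} :=
  ⟨i, (P i).part v, (P i).part_mem.2 (mem_univ v)⟩

theorem mem_iff_eq_partVertex {v : S} {w : Σ i : ι, {A : Finset S // A ∈ (P i).parts}} :
    v ∈ w.2.1 ↔ w = partVertex P v w.1 := by
  obtain ⟨i, A, hA⟩ := w
  constructor
  · intro h
    simp only [partVertex, Sigma.mk.injEq, heq_eq_eq, true_and, Subtype.mk.injEq]
    exact ((P i).part_eq_of_mem hA h).symm
  · intro h
    simp only [partVertex, Sigma.mk.injEq, heq_eq_eq, true_and, Subtype.mk.injEq] at h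
    exact h ▸ (P i).mem_part (mem_univ v)

theorem partVertex_injective (v : S) : Function.Injective (partVertex P v) :=
  fun _ _ h => congrArg Sigma.fst h

theorem neighborSet_partGraph_inl (v : S) :
    (partGraph P).neighborSet (Sum.inl v) = Set.range (Sum.inr ∘ partVertex P v) := by
  ext x
  rw [SimpleGraph.mem_neighborSet]
  cases x with
  | inl u => simp [partGraph]
  | inr w =>
    change v ∈ w.2.1 ↔ _
    rw [mem_iff_eq_partVertex]
    constructor
    · intro h
      exact ⟨w.1, congrArg Sum.inr h.symm⟩
    · rintro ⟨i, hi⟩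
      have : partVertex P v i = w := Sum.inr_injective hi
      rw [← this]
      rfl

theorem neighborSet_partGraph_inr (w : Σ i : ι, {A : Finset S // A ∈ (P i).parts}) :
    (partGraph P).neighborSet (Sum.inr w) = Sum.inl '' (w.2.1 : Set S) := by
  ext x
  rw [SimpleGraph.mem_neighborSet]
  cases x <;> simp [partGraph]

/-- `S` is independent in the graph, so only distance 2 matters, and the midpoint of a path of
length 2 is the vertex of a common part. -/
theorem square_partGraph_adj_inl {u v : S} :
    (square (partGraph P)).Adj (Sum.inl u) (Sum.inl v) ↔ u ≠ v ∧ ∃ i, v ∈ (P i).part u := by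
  have hn : ¬ (partGraph P).Adj (Sum.inl u) (Sum.inl v) := fun h => h
  change (_ ∨ _) ↔ _
  constructor
  · rintro (h | h)
    · exact absurd h hn
    · refine ⟨?_, ?_⟩
      · rintro rfl
        simp at h
      -- `dist` is 0 between unreachable vertices, so the value 2 yields a walk.
      · have hreach : (partGraph P).Reachable (Sum.inl u) (Sum.inl v) := by
          by_contra hr
          rw [SimpleGraph.dist_eq_zero_of_not_reachable hr] at h
          omega
        obtain ⟨p, hp⟩ := hreach.exists_walk_length_eq_dist
        rw [h] at hp
        have h1 := p.adj_getVert_succ (i := 0) (by omega)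
        have h2 := p.adj_getVert_succ (i := 1) (by omega)
        rw [p.getVert_zero] at h1
        rw [show 1 + 1 = p.length from hp.symm, p.getVert_length] at h2
        rcases hx : p.getVert (0 + 1) with x | w
        · rw [hx] at h1
          exact absurd h1 fun h => h
        · rw [hx] at h1
          rw [show p.getVert 1 = Sum.inr w from hx] at h2
          have h1 : u ∈ w.2.1 := h1
          have h2 : v ∈ w.2.1 := h2
          refine ⟨w.1, ?_⟩
          rwa [(P w.1).part_eq_of_mem w.2.2 h1]
  · rintro ⟨huv, i, hi⟩
    right
    have h1 : (partGraph P).Adj (Sum.inl u) (Sum.inr (partVertex P u i)) :=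
      (P i).mem_part (mem_univ u)
    have h2 : (partGraph P).Adj (Sum.inr (partVertex P u i)) (Sum.inl v) := hi
    have hle := SimpleGraph.dist_le (SimpleGraph.Walk.cons h1 h2.toWalk)
    simp only [SimpleGraph.Walk.length_cons, SimpleGraph.Walk.length_nil,
      SimpleGraph.Adj.toWalk] at hle
    have h0 : (partGraph P).dist (Sum.inl u) (Sum.inl v) ≠ 0 := by
      rw [(h1.reachable.trans h2.reachable).dist_eq_zero_iff.ne]
      exact fun h => huv (Sum.inl_injective h)
    have h3 : (partGraph P).dist (Sum.inl u) (Sum.inl v) ≠ 1 := by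
      rw [Ne, SimpleGraph.dist_eq_one_iff_adj]
      exact hn
    omega

end PartGraph

/-! ### Degeneracy and degrees -/

section IsPartitionSystem

variable {S : Type*} [Fintype S] [DecidableEq S] {k D : ℕ}
  {P : Fin D → Finpartition (univ : Finset S)}

theorem IsPartitionSystem.card_eq_partSize (h : IsPartitionSystem k D P) (i : Fin D)
    {A : Finset S} (hA : A ∈ (P i).parts) : #A = partSize k D i := by
  unfold partSize
  split_ifs with hi
  · exact h.card_first i hi A hA
  · exact h.card_second i (not_lt.1 hi) A hA

/-- A subgraph containing the vertex of a late part (size `k`) has degree at most `k` there.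
Otherwise an element of `S` sees only vertices of the first `k` partitions, one for each. With no
element of `S` there are no edges. -/
theorem IsPartitionSystem.isDegenerate (h : IsPartitionSystem k D P) :
    IsDegenerate k (partGraph P) := by
  intro H hH
  by_cases h1 : ∃ w, Sum.inr w ∈ H.verts ∧ k ≤ (w.1 : ℕ)
  · obtain ⟨w, hw, hkw⟩ := h1
    refine ⟨_, hw, (Set.encard_le_encard (H.neighborSet_subset _)).trans ?_⟩
    rw [neighborSet_partGraph_inr, Sum.inl_injective.encard_image, Set.encard_coe_eq_coe_finsetCard,
      h.card_second w.1 hkw w.2.1 w.2.2]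
  · push Not at h1
    by_cases h2 : ∃ v, Sum.inl v ∈ H.verts
    · obtain ⟨v, hv⟩ := h2
      refine ⟨_, hv, ?_⟩
      have hsub : H.neighborSet (Sum.inl v) ⊆
          (fun i => Sum.inr (partVertex P v i)) '' {i : Fin D | (i : ℕ) < k} := by
        intro x hx
        have hx' := H.neighborSet_subset _ hx
        rw [neighborSet_partGraph_inl] at hx'
        obtain ⟨i, rfl⟩ := hx'
        exact ⟨i, h1 _ (H.edge_vert (H.adj_symm hx)), rfl⟩
      refine (Set.encard_le_encard hsub).trans ((Set.encard_image_le _ _).trans ?_)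
      rw [← Fin.val_injective.encard_image]
      refine (Set.encard_le_encard (t := ((range k : Finset ℕ) : Set ℕ)) ?_).trans ?_
      · rintro _ ⟨i, hi, rfl⟩
        simpa using hi
      · rw [Set.encard_coe_eq_coe_finsetCard, card_range]
    · obtain ⟨x, hx⟩ := hH
      refine ⟨x, hx, ?_⟩
      have : H.neighborSet x = ∅ := by
        rw [Set.eq_empty_iff_forall_notMem]
        intro y hy
        have hadj := H.adj_sub hy
        have hy' := H.edge_vert (H.adj_symm hy)
        rcases x with v | w
        · exact h2 ⟨v, hx⟩
        · rcases y with v | w'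
          · exact h2 ⟨v, hy'⟩
          · exact hadj
      simp [this]

theorem IsPartitionSystem.maxDegree_eq [Nonempty S] (h : IsPartitionSystem k D P) (hkD : k ≤ D)
    [DecidableRel (partGraph P).Adj] : (partGraph P).maxDegree = D := by
  have hinl : ∀ v, (partGraph P).degree (Sum.inl v) = D := by
    intro v
    rw [← SimpleGraph.card_neighborSet_eq_degree, ← Set.toFinset_card,
      ← Set.ncard_eq_toFinset_card', neighborSet_partGraph_inl,
      ← Set.image_univ, Set.ncard_image_of_injective _
        (Sum.inr_injective.comp (partVertex_injective P v)), Set.ncard_univ, Nat.card_fin]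
  apply le_antisymm
  · refine SimpleGraph.maxDegree_le_of_forall_degree_le _ _ ?_
    rintro (v | w)
    · exact (hinl v).le
    · rw [← SimpleGraph.card_neighborSet_eq_degree, ← Set.toFinset_card,
        ← Set.ncard_eq_toFinset_card', neighborSet_partGraph_inr,
        Set.ncard_image_of_injective _ Sum.inl_injective, Set.ncard_coe_finset,
        h.card_eq_partSize w.1 w.2.2, partSize]
      split_ifs
      · rfl
      · exact hkD
  · obtain ⟨v⟩ := ‹Nonempty S›
    exact (hinl v).ge.trans (SimpleGraph.degree_le_maxDegree _ _)

/-- The parts through `v` meet pairwise only in `v`, so their sizes less one add up exactly. -/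
theorem IsPartitionSystem.encard_square (h : IsPartitionSystem k D P) (hkD : k ≤ D) (v : S) :
    {u | (square (partGraph P)).Adj (Sum.inl v) (Sum.inl u)}.encard
      = (k * (D - 1) + (D - k) * (k - 1) : ℕ) := by
  have : {u | (square (partGraph P)).Adj (Sum.inl v) (Sum.inl u)} =
      ((univ.biUnion fun i => ((P i).part v).erase v : Finset S) : Set S) := by
    ext u
    simp only [Set.mem_ofPred_eq, square_partGraph_adj_inl, coe_biUnion, Set.mem_iUnion, mem_coe,
      mem_univ, mem_erase, exists_prop, true_and, exists_and_left, ne_comm]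
  rw [this, Set.encard_coe_eq_coe_finsetCard,
    card_biUnion_part_erase (sz := fun i : Fin D => partSize k D i)
      (fun i _ A hA => h.card_eq_partSize i hA), ← sum_range_partSize hkD,
    Finset.sum_range]
  intro i _ j _ u v huv hi hj
  exact h.at_most_once i j _ ((P i).part_mem.2 (mem_univ u)) _ ((P j).part_mem.2 (mem_univ u)) u v
    huv ((P i).mem_part (mem_univ u)) hi ((P j).mem_part (mem_univ u)) hj

theorem IsPartitionSystem.not_isDegenerate_square [Nonempty S] (h : IsPartitionSystem k D P)
    (hkD : k ≤ D) {d : ℕ} (hd : d < k * (D - 1) + (D - k) * (k - 1)) :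
    ¬ IsDegenerate d (square (partGraph P)) := by
  intro hdeg
  obtain ⟨x, ⟨v, rfl⟩, hx⟩ := hdeg ((⊤ : (square (partGraph P)).Subgraph).induce (Set.range Sum.inl))
    (Set.range_nonempty _)
  have : ((⊤ : (square (partGraph P)).Subgraph).induce (Set.range Sum.inl)).neighborSet
      (Sum.inl v) = Sum.inl '' {u | (square (partGraph P)).Adj (Sum.inl v) (Sum.inl u)} := by
    ext y
    simp only [SimpleGraph.Subgraph.mem_neighborSet, SimpleGraph.Subgraph.induce_adj,
      SimpleGraph.Subgraph.top_adj, Set.mem_range, Set.mem_image, Set.mem_ofPred_eq]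
    constructor
    · rintro ⟨-, ⟨u, rfl⟩, hu⟩
      exact ⟨u, hu, rfl⟩
    · rintro ⟨u, hu, rfl⟩
      exact ⟨⟨v, rfl⟩, ⟨u, rfl⟩, hu⟩
  rw [this, Sum.inl_injective.encard_image, h.encard_square hkD, Nat.cast_le] at hx
  omega

theorem IsPartitionSystem.degree_induce_square (h : IsPartitionSystem k D P) (hkD : k ≤ D)
    (x : Set.range (Sum.inl : S → Vertex P))
    [Fintype (((square (partGraph P)).induce (Set.range Sum.inl)).neighborSet x)] :
    ((square (partGraph P)).induce (Set.range (Sum.inl : S → Vertex P))).degree x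
      = k * (D - 1) + (D - k) * (k - 1) := by
  obtain ⟨_, v, rfl⟩ := x
  rw [← SimpleGraph.card_neighborSet_eq_degree, ← Nat.cast_inj (R := ℕ∞),
    ← h.encard_square hkD v, ← Set.toFinset_card, ← Set.ncard_eq_toFinset_card',
    (Set.toFinite _).cast_ncard_eq, ← Subtype.val_injective.encard_image,
    ← (Sum.inl_injective (α := S)).encard_image]
  congr 1
  ext y
  simp only [Set.mem_image, SimpleGraph.mem_neighborSet, SimpleGraph.comap_adj,
    Function.Embedding.subtype_apply, Set.mem_ofPred_eq]
  constructor
  · rintro ⟨⟨_, u, rfl⟩, hu, rfl⟩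
    exact ⟨u, hu, rfl⟩
  · rintro ⟨u, hu, rfl⟩
    exact ⟨⟨_, u, rfl⟩, hu, rfl⟩

end IsPartitionSystem

end SquareDegeneracy

open scoped Classical
theorem mainTheorem8 (k D : ℕ) (hk : 2 ≤ k) (hkD : k ≤ D)
    (N : ℕ) (hN : 2 * k * D ^ 2 ≤ N) (hdvd : k * D ∣ N) :
    ∃ P : Fin D → Finpartition (Finset.univ : Finset (Fin N)),
      SquareDegeneracy.IsPartitionSystem k D P ∧
      SquareDegeneracy.IsDegenerate k (SquareDegeneracy.partGraph P) ∧
      (SquareDegeneracy.partGraph P).maxDegree = D ∧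
      ¬ SquareDegeneracy.IsDegenerate ((2 * k - 1) * D - k ^ 2 - 1)
          (SquareDegeneracy.square (SquareDegeneracy.partGraph P)) ∧
      ((SquareDegeneracy.square (SquareDegeneracy.partGraph P)).induce
          (Set.range (Sum.inl : Fin N → SquareDegeneracy.Vertex P))).minDegree
        = k * (D - 1) + (D - k) * (k - 1) := by
  obtain ⟨P, hP⟩ := SquareDegeneracy.exists_isPartitionSystem hk hkD hN hdvd
  have hN0 : 0 < N := lt_of_lt_of_le (by have : 0 < D := by omega
                                         positivity) hN
  have : Nonempty (Fin N) := ⟨⟨0, hN0⟩⟩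
  refine ⟨P, hP, hP.isDegenerate, hP.maxDegree_eq hkD,
    hP.not_isDegenerate_square hkD ?_, ?_⟩
  -- Writing `k = 2 + l` and `D = k + d` removes the truncated subtractions.
  · obtain ⟨d, rfl⟩ := Nat.exists_eq_add_of_le hkD
    obtain ⟨l, rfl⟩ := Nat.exists_eq_add_of_le hk
    have h1 : 2 * (2 + l) - 1 = 3 + 2 * l := by omega
    have h2 : 2 + l + d - 1 = 1 + l + d := by omega
    have h3 : 2 + l + d - (2 + l) = d := by omega
    have h4 : 2 + l - 1 = 1 + l := by omega
    rw [h1, h2, h3, h4, Nat.sub_sub, Nat.sub_lt_iff_lt_add (by nlinarith)]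
    nlinarith
  · have : Nonempty (Set.range (Sum.inl : Fin N → SquareDegeneracy.Vertex P)) :=
      (Set.range_nonempty _).to_subtype
    obtain ⟨x, hx⟩ := SimpleGraph.exists_minimal_degree_vertex
      ((SquareDegeneracy.square (SquareDegeneracy.partGraph P)).induce
        (Set.range (Sum.inl : Fin N → SquareDegeneracy.Vertex P)))
    rw [hx]
    exact hP.degree_induce_square hkD x
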